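/- For a graph $G$ let $c(G)$ be the set of all connected graphs that contain $G$ as a (not necessarily induced) subgraph, and let $nK_4$ denote the disjoint union of $n$ copies of the complete graph $K_4$. For a graph $G$, let $R_2(G)$ be the least integer $N$ such that every colouring of the edges of the complete graph $K_N$ with two colours contains a monochromatic copy of $G$; let $R_2(c(G))$ be the least integer $N$ such that every colouring of the edges of $K_N$ with two colours contains a monochromatic copy of some graph in $c(G)$. Then $R_2(c(nK_4)) = 13n-3$ for every integer $n \geq 3$. Furthermore, if $R_2(2K_4) \leq 23$, then $R_2(c(2K_4)) = 23$. -/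

import Mathlib

open scoped SimpleGraph

namespace RamseyClique

/-- A family of finite graphs, given by representatives on the vertex sets `Fin m`. -/
abbrev GraphFamily := Set (Σ m : ℕ, SimpleGraph (Fin m))

/-- `n` vertex-disjoint copies of the complete graph on `r` vertices. The vertex `(i, a)` is the
`a`-th vertex of the `i`-th copy. -/
def copiesOfComplete (n r : ℕ) : SimpleGraph (Fin n × Fin r) where
  Adj x y := x.1 = y.1 ∧ x.2 ≠ y.2
  symm := ⟨fun _ _ h => ⟨h.1.symm, h.2.symm⟩⟩
  loopless := ⟨fun _ h => h.2 rfl⟩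

/-- The family consisting of the single graph `G` (up to isomorphism). -/
def singleGraph {V : Type*} (G : SimpleGraph V) : GraphFamily :=
  {H | Nonempty (H.2 ≃g G)}

/-- The family `c(G)` of all connected graphs containing `G` as a (not necessarily induced)
subgraph. -/
def connectedContaining {V : Type*} (G : SimpleGraph V) : GraphFamily :=
  {H | H.2.Connected ∧ G ⊑ H.2}

/-- Every `k`-edge-colouring of the complete graph on `N` vertices contains a monochromatic copy
of some member of the family `F`. -/
def Arrows (k N : ℕ) (F : GraphFamily) : Prop :=
  ∀ C : SimpleGraph.TopEdgeLabeling (Fin N) (Fin k),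
    ∃ c : Fin k, ∃ H ∈ F, H.2 ⊑ C.labelGraph c

/-- `R_k(F) = R`: the least `N` such that every `k`-edge-colouring of the complete graph on `N`
vertices contains a monochromatic copy of a member of `F` exists and equals `R`. -/
def IsRamseyNumber (k : ℕ) (F : GraphFamily) (R : ℕ) : Prop :=
  IsLeast {N : ℕ | Arrows k N F} R

end RamseyClique

/-! Lower bound: on `13 * n - 4` vertices let one colour form disjoint cliques of orders `4n-1`,
`4n-1`, `4n-1`, `n-1`. Its components are too small for `n` copies of `K₄`, while every `K₄` of the
other colour uses a vertex of the last block.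

Upper bound: if `G` and `Gᶜ` are both connected, it suffices to find `n` disjoint copies of `K₄` in
one colour. For `n ≥ 3` a greedy argument with `R(4,4) ≤ 18` gives them; for `n = 2` they are the
extra hypothesis.

If `G` is disconnected, then `Gᶜ` is connected and joins the parts of any cut completely, so copies
of `K₄` in `Gᶜ` can be assembled from smaller cliques in the parts. The key is
`matching_or_linkedPacking`: unless `G` has `n` linked copies of `K₄`, a part with at least `4n+m-1`
vertices, `m ≤ n`, contains `m` disjoint edges of `Gᶜ`. Take a largest cut `A` with at most `5n-2`
vertices. Either its complement is connected in `G`, and independent sets found there by Ramsey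
bounds are completed with vertices of `A`, or the vertices split into three parts, and each `K₄` is
an edge plus two single vertices. -/

namespace RamseyClique

open Finset

/-! ### Small Ramsey bounds: `R(3,3) ≤ 6`, `R(4,3) ≤ 9`, `R(4,4) ≤ 18`. -/

section Ramsey

variable {V : Type*} {G : SimpleGraph V} {U W : Finset V} {s t : ℕ}

/-- The set `U` contains an `s`-clique of `G` or an independent `t`-set of `G`. -/
def HasCliqueOrIndep (G : SimpleGraph V) (U : Finset V) (s t : ℕ) : Prop :=
  ∃ K ⊆ U, G.IsNClique s K ∨ Gᶜ.IsNClique t K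

lemma HasCliqueOrIndep.mono (h : HasCliqueOrIndep G U s t) (hUW : U ⊆ W) :
    HasCliqueOrIndep G W s t :=
  let ⟨K, hK, h⟩ := h
  ⟨K, hK.trans hUW, h⟩

lemma HasCliqueOrIndep.of_compl (h : HasCliqueOrIndep Gᶜ U t s) : HasCliqueOrIndep G U s t := by
  obtain ⟨K, hK, h | h⟩ := h
  · exact ⟨K, hK, .inr h⟩
  · exact ⟨K, hK, .inl (by simpa using h)⟩

lemma hasCliqueOrIndep_of_neighbors [DecidableEq V] {a : V} (ha : a ∈ U) (hW : W ⊆ U)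
    (hadj : ∀ b ∈ W, G.Adj a b) (h : HasCliqueOrIndep G W s t) :
    HasCliqueOrIndep G U (s + 1) t := by
  obtain ⟨K, hK, h | h⟩ := h
  · exact ⟨insert a K, insert_subset ha (hK.trans hW),
      .inl (h.insert fun b hb => hadj b (hK hb))⟩
  · exact ⟨K, hK.trans hW, .inr h⟩

lemma hasCliqueOrIndep_two (h : s ≤ #U) : HasCliqueOrIndep G U s 2 := by
  obtain ⟨K, hK, hcard⟩ := exists_subset_card_eq h
  by_cases hc : G.IsClique K
  · exact ⟨K, hK, .inl ⟨hc, hcard⟩⟩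
  · classical
    rw [SimpleGraph.isClique_iff, Set.Pairwise] at hc
    push Not at hc
    obtain ⟨x, hx, y, hy, hne, hadj⟩ := hc
    refine ⟨{x, y}, ?_, .inr ⟨?_, card_pair hne⟩⟩
    · exact insert_subset (hK hx) (singleton_subset_iff.2 (hK hy))
    · rw [coe_pair]
      exact SimpleGraph.isClique_pair.2 fun _ => ⟨hne, hadj⟩

open scoped Classical in
lemma card_adj_add_card_not_adj {a : V} (ha : a ∈ U) :
    #{b ∈ U | G.Adj a b} + #{b ∈ U | Gᶜ.Adj a b} + 1 = #U := by
  rw [← card_union_of_disjoint, ← card_erase_add_one ha]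
  · congr 2
    ext b
    simp only [mem_union, mem_filter, SimpleGraph.compl_adj, mem_erase]
    have : G.Adj a b → a ≠ b := fun h => h.ne
    grind
  · rw [disjoint_filter]
    intro b _ h
    simp [h]

open scoped Classical in
lemma hasCliqueOrIndep_step {p q : ℕ} (hs : ∀ W ⊆ U, p ≤ #W → HasCliqueOrIndep G W s (t + 1))
    (ht : ∀ W ⊆ U, q ≤ #W → HasCliqueOrIndep G W (s + 1) t) (hU : p + q ≤ #U) (hp : 0 < p) :
    HasCliqueOrIndep G U (s + 1) (t + 1) := by
  obtain ⟨a, ha⟩ : U.Nonempty := card_pos.1 (by omega)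
  have := card_adj_add_card_not_adj (G := G) ha
  by_cases h : p ≤ #{b ∈ U | G.Adj a b}
  · exact hasCliqueOrIndep_of_neighbors ha (filter_subset _ _) (by simp)
      (hs _ (filter_subset _ _) h)
  · have hq := ht _ (filter_subset (Gᶜ.Adj a ·) U) (by omega)
    refine HasCliqueOrIndep.of_compl (hasCliqueOrIndep_of_neighbors ha
      (filter_subset (Gᶜ.Adj a ·) U) (by simp) (HasCliqueOrIndep.of_compl ?_))
    simpa using hq

lemma hasCliqueOrIndep_three_three (hU : 6 ≤ #U) : HasCliqueOrIndep G U 3 3 :=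
  hasCliqueOrIndep_step (p := 3) (q := 3)
    (fun _ _ h => .of_compl (hasCliqueOrIndep_two h))
    (fun _ _ h => hasCliqueOrIndep_two h) hU (by norm_num)

open scoped Classical in
lemma even_card_mul_of_regular {d : ℕ} (h : ∀ a ∈ U, #{b ∈ U | G.Adj a b} = d) :
    Even (#U * d) := by
  have hdeg : ∀ a : U, (G.induce (U : Set V)).degree a = d := by
    rintro ⟨a, ha⟩
    rw [← h a ha, ← SimpleGraph.card_neighborFinset_eq_degree]
    refine card_bij (fun b _ => b.1) ?_ ?_ ?_
    · intro b hb
      simpa using hb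
    · intro b _ c _ hbc
      exact Subtype.ext hbc
    · intro b hb
      rw [mem_filter] at hb
      exact ⟨⟨b, hb.1⟩, by simpa using hb.2, rfl⟩
  have hsum := SimpleGraph.sum_degrees_eq_twice_card_edges (G.induce (U : Set V))
  have h2 : ∑ a : U, (G.induce (U : Set V)).degree a = #U * d := by
    rw [sum_congr rfl fun a _ => hdeg a]
    simp
  rw [← h2]
  exact hsum ▸ even_two_mul _

/-- The recursion only gives 10. On exactly 9 vertices a counterexample has fewer than 6 neighbours
and fewer than 4 non-neighbours at each vertex, hence is 3-regular in the complement, which parity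
forbids. -/
lemma hasCliqueOrIndep_four_three (hU : 9 ≤ #U) : HasCliqueOrIndep G U 4 3 := by
  classical
  obtain ⟨W, hWU, hW⟩ := exists_subset_card_eq hU
  refine HasCliqueOrIndep.mono ?_ hWU
  by_contra hcon
  have hreg : ∀ a ∈ W, #{b ∈ W | Gᶜ.Adj a b} = 3 := by
    intro a ha
    have hsum := card_adj_add_card_not_adj (G := G) ha
    have h6 : #{b ∈ W | G.Adj a b} < 6 := by
      by_contra! h
      exact hcon (hasCliqueOrIndep_of_neighbors ha (filter_subset _ _) (by simp)
        (hasCliqueOrIndep_three_three h))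
    have h4 : #{b ∈ W | Gᶜ.Adj a b} < 4 := by
      by_contra! h
      exact hcon (HasCliqueOrIndep.of_compl (hasCliqueOrIndep_of_neighbors ha
        (filter_subset (Gᶜ.Adj a ·) W) (by simp) (.of_compl (by
          simpa using hasCliqueOrIndep_two (G := G) h))))
    omega
  have := even_card_mul_of_regular (G := Gᶜ) (U := W) (d := 3) (by convert hreg)
  rw [hW] at this
  exact absurd this (by decide)

lemma hasCliqueOrIndep_four_four (hU : 18 ≤ #U) : HasCliqueOrIndep G U 4 4 :=
  hasCliqueOrIndep_step (p := 9) (q := 9)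
    (fun _ _ h => .of_compl (hasCliqueOrIndep_four_three h))
    (fun _ _ h => hasCliqueOrIndep_four_three h) hU (by norm_num)

end Ramsey

/-! ### Greedy clique packings, and matchings in the complement. -/

section Packing

variable {V : Type*} {G : SimpleGraph V} {S T : Finset V} {n m k : ℕ} {w w' : ℕ → ℕ}

/-- Sets chosen greedily in `S`, the `i`-th one with property `P i`, when `c i` bounds the number of
elements covered by the first `i` sets. The first `k` sets are given. -/
lemma exists_disjoint_family_extending [DecidableEq V] {P : ℕ → Finset V → Prop} {c : ℕ → ℕ}
    (hkn : k ≤ n) {K₀ : ℕ → Finset V} (hK₀ : ∀ i < k, K₀ i ⊆ S ∧ P i (K₀ i))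
    (hdisj : ∀ i < k, ∀ j < k, i ≠ j → Disjoint (K₀ i) (K₀ j))
    (hcard : #((range k).biUnion K₀) ≤ c k)
    (step : ∀ i, k ≤ i → i < n → ∀ U ⊆ S, #S ≤ #U + c i →
      ∃ K ⊆ U, P i K ∧ #K + c i ≤ c (i + 1)) :
    ∃ K : ℕ → Finset V, (∀ i < n, K i ⊆ S ∧ P i (K i)) ∧
      (∀ i < n, ∀ j < n, i ≠ j → Disjoint (K i) (K j)) := by
  suffices h : ∃ K : ℕ → Finset V, (∀ i < n, K i ⊆ S ∧ P i (K i)) ∧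
      (∀ i < n, ∀ j < n, i ≠ j → Disjoint (K i) (K j)) ∧ #((range n).biUnion K) ≤ c n by
    obtain ⟨K, h1, h2, -⟩ := h
    exact ⟨K, h1, h2⟩
  induction n, hkn using Nat.le_induction with
  | base => exact ⟨K₀, hK₀, hdisj, hcard⟩
  | succ n hkn ih =>
    obtain ⟨K, hK, hKd, hKc⟩ := ih fun i hi hin => step i hi (by omega)
    have hU : #S ≤ #(S \ (range n).biUnion K) + c n := by
      have := le_card_sdiff ((range n).biUnion K) S
      omega
    obtain ⟨L, hLU, hPL, hLc⟩ := step n hkn (by omega) _ sdiff_subset hU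
    have hLd : ∀ i < n, Disjoint (K i) L := by
      intro i hi
      refine disjoint_left.2 fun x hx hxL => (mem_sdiff.1 (hLU hxL)).2 ?_
      exact mem_biUnion.2 ⟨i, mem_range.2 hi, hx⟩
    have hlt : ∀ i < n, Function.update K n L i = K i := fun i hi =>
      Function.update_of_ne hi.ne _ _
    have hn : Function.update K n L n = L := Function.update_self ..
    refine ⟨Function.update K n L, ?_, ?_, ?_⟩
    · intro i hi
      rcases Nat.lt_succ_iff_lt_or_eq.1 hi with hi | rfl
      · rw [hlt i hi]; exact hK i hi
      · rw [hn]; exact ⟨hLU.trans sdiff_subset, hPL⟩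
    · intro i hi j hj hij
      rcases Nat.lt_succ_iff_lt_or_eq.1 hi with hi | rfl <;>
        rcases Nat.lt_succ_iff_lt_or_eq.1 hj with hj | rfl
      · rw [hlt i hi, hlt j hj]; exact hKd i hi j hj hij
      · rw [hlt i hi, hn]; exact hLd i hi
      · rw [hlt j hj, hn]; exact (hLd j hj).symm
      · exact absurd rfl hij
    · rw [range_add_one, biUnion_insert, hn,
        biUnion_congr rfl fun i hi => hlt i (mem_range.1 hi)]
      have := card_union_le L ((range n).biUnion K)
      omega

lemma exists_disjoint_family {P : ℕ → Finset V → Prop} {c : ℕ → ℕ}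
    (step : ∀ i < n, ∀ U ⊆ S, #S ≤ #U + c i → ∃ K ⊆ U, P i K ∧ #K + c i ≤ c (i + 1)) :
    ∃ K : ℕ → Finset V, (∀ i < n, K i ⊆ S ∧ P i (K i)) ∧
      (∀ i < n, ∀ j < n, i ≠ j → Disjoint (K i) (K j)) := by
  classical
  exact exists_disjoint_family_extending (k := 0) (K₀ := fun _ => ∅) (c := c) (by omega)
    (by simp) (by simp) (by simp) fun i _ hi => step i hi

/-- There are `n` pairwise disjoint cliques of `G` inside `S`, the `i`-th one of size `w i`. -/
def CliquePacking (G : SimpleGraph V) (S : Finset V) (n : ℕ) (w : ℕ → ℕ) : Prop :=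
  ∃ K : ℕ → Finset V, (∀ i < n, K i ⊆ S ∧ G.IsNClique (w i) (K i)) ∧
    (∀ i < n, ∀ j < n, i ≠ j → Disjoint (K i) (K j))

lemma CliquePacking.mono (h : CliquePacking G S n w) (hST : S ⊆ T) : CliquePacking G T n w :=
  let ⟨K, hK, hd⟩ := h
  ⟨K, fun i hi => ⟨(hK i hi).1.trans hST, (hK i hi).2⟩, hd⟩

lemma CliquePacking.congr (h : CliquePacking G S n w) (hw : ∀ i < n, w i = w' i) :
    CliquePacking G S n w' :=
  let ⟨K, hK, hd⟩ := h
  ⟨K, fun i hi => ⟨(hK i hi).1, hw i hi ▸ (hK i hi).2⟩, hd⟩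

lemma CliquePacking.reindex (h : CliquePacking G S n w) {σ : ℕ → ℕ} (hσ : ∀ i < n, σ i < n)
    (hinj : ∀ i < n, ∀ j < n, i ≠ j → σ i ≠ σ j) : CliquePacking G S n (w ∘ σ) :=
  let ⟨K, hK, hd⟩ := h
  ⟨K ∘ σ, fun i hi => hK _ (hσ i hi),
    fun i hi j hj hij => hd _ (hσ i hi) _ (hσ j hj) (hinj i hi j hj hij)⟩

/-- Cliques of two packings in completely joined sets can be merged one by one. -/
lemma CliquePacking.join [DecidableEq V] (h : CliquePacking G S n w) (h' : CliquePacking G T n w')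
    (hST : ∀ x ∈ S, ∀ y ∈ T, G.Adj x y) : CliquePacking G (S ∪ T) n fun i => w i + w' i := by
  obtain ⟨K, hK, hd⟩ := h
  obtain ⟨L, hL, hd'⟩ := h'
  have hdST : Disjoint S T := disjoint_left.2 fun x hx hy => (hST x hx x hy).ne rfl
  refine ⟨fun i => K i ∪ L i, fun i hi => ⟨union_subset_union (hK i hi).1 (hL i hi).1, ?_, ?_⟩, ?_⟩
  · intro x hx y hy hxy
    rw [mem_coe, mem_union] at hx hy
    rcases hx with hx | hx <;> rcases hy with hy | hy
    · exact (hK i hi).2.1 hx hy hxy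
    · exact hST x ((hK i hi).1 hx) y ((hL i hi).1 hy)
    · exact (hST y ((hK i hi).1 hy) x ((hL i hi).1 hx)).symm
    · exact (hL i hi).2.1 hx hy hxy
  · rw [card_union_of_disjoint (hdST.mono (hK i hi).1 (hL i hi).1), (hK i hi).2.2, (hL i hi).2.2]
  · intro i hi j hj hij
    rw [disjoint_union_left, disjoint_union_right, disjoint_union_right]
    exact ⟨⟨hd i hi j hj hij, hdST.mono (hK i hi).1 (hL j hj).1⟩,
      (hdST.mono (hK j hj).1 (hL i hi).1).symm, hd' i hi j hj hij⟩

lemma cliquePacking_of_step {c : ℕ → ℕ} (hc : ∀ i < n, w i + c i ≤ c (i + 1))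
    (step : ∀ i < n, ∀ U ⊆ S, #S ≤ #U + c i → ∃ K ⊆ U, G.IsNClique (w i) K) :
    CliquePacking G S n w := by
  refine exists_disjoint_family (c := c) fun i hi U hU hcard => ?_
  obtain ⟨K, hKU, hK⟩ := step i hi U hU hcard
  exact ⟨K, hKU, hK, by rw [hK.2]; exact hc i hi⟩

/-- A packing of `m` edges extends by single vertices. -/
lemma CliquePacking.extend_singletons (h : CliquePacking G S m fun _ => 2) (hmn : m ≤ n)
    (hS : n + m ≤ #S) : CliquePacking G S n fun i => if i < m then 2 else 1 := by
  classical
  obtain ⟨K, hK, hd⟩ := h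
  -- At stage `i ≥ m` the sets chosen are `m` edges and `i - m` single vertices, covering `i + m`
  -- elements.
  refine exists_disjoint_family_extending (c := fun i => i + m)
    (P := fun i L => G.IsNClique (if i < m then 2 else 1) L) hmn (K₀ := K)
    (fun i hi => ?_) hd ?_ ?_
  · rw [if_pos hi]
    exact hK i hi
  · refine card_biUnion_le.trans ?_
    rw [sum_congr rfl fun i hi => (hK i (mem_range.1 hi)).2.2]
    simp
    omega
  · intro i hi hin U _ hU
    obtain ⟨x, hx⟩ : U.Nonempty := card_pos.1 (by omega)
    refine ⟨{x}, singleton_subset_iff.2 hx, ?_, ?_⟩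
    · rw [if_neg (by omega)]
      simp
    · rw [card_singleton]
      omega

/-- The `m` edges of a packing may be put at any positions `a, …, a + m - 1`. -/
lemma CliquePacking.extend_singletons_shift {a : ℕ} (h : CliquePacking G S m fun _ => 2)
    (hmn : a + m ≤ n) (hS : n + m ≤ #S) :
    CliquePacking G S n fun i => if a ≤ i ∧ i < a + m then 2 else 1 := by
  -- A cyclic shift by `a`, which moves the edges from the first `m` positions to those starting at
  -- `a`.
  refine ((h.extend_singletons (by omega) hS).reindex
    (σ := fun i => if i < a then i + n - a else i - a) ?_ ?_).congr ?_
  · intro i hi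
    split_ifs <;> omega
  · intro i hi j hj hij
    split_ifs <;> omega
  · intro i hi
    simp only [Function.comp]
    split_ifs <;> omega

lemma cliquePacking_singletons (hS : n ≤ #S) : CliquePacking G S n fun _ => 1 := by
  have h : CliquePacking G S 0 fun _ => 2 := ⟨fun _ => ∅, by simp, by simp⟩
  refine (h.extend_singletons (Nat.zero_le n) (by omega)).congr ?_
  simp

/-- A maximal packing of copies of `K₄` leaves a set without `K₄`. -/
lemma cliquePacking_four_or_exists_residual (S : Finset V) (n : ℕ) :
    CliquePacking G S (n + 1) (fun _ => 4) ∨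
      ∃ T ⊆ S, #S ≤ #T + 4 * n ∧ ∀ K ⊆ T, ¬ G.IsNClique 4 K := by
  classical
  by_contra! hcon
  refine hcon.1 (cliquePacking_of_step (c := fun i => 4 * i) (fun i _ => by omega) ?_)
  intro i hi U hU hcard
  by_contra! hK
  obtain ⟨K, hKU, hK'⟩ := hcon.2 U hU (by omega)
  exact hK K hKU hK'

/-- There are `n` pairwise disjoint copies of `K₄` in a single connected component of `G`. -/
def LinkedPacking (G : SimpleGraph V) (n : ℕ) : Prop :=
  ∃ K : ℕ → Finset V, (∀ i < n, G.IsNClique 4 (K i)) ∧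
    (∀ i < n, ∀ j < n, i ≠ j → Disjoint (K i) (K j)) ∧
      ∃ z, ∀ i < n, ∀ x ∈ K i, G.Reachable z x

lemma CliquePacking.linkedPacking (h : CliquePacking G S n fun _ => 4) {z : V}
    (hz : ∀ x ∈ S, G.Reachable z x) : LinkedPacking G n :=
  let ⟨K, hK, hd⟩ := h
  ⟨K, fun i hi => (hK i hi).2, hd, z, fun i hi x hx => hz x ((hK i hi).1 hx)⟩

/-- A vertex set with more than `4 * n + m - 2` vertices contains a matching with `m` edges in the
complement of `G`, or else `n` disjoint copies of `K₄` in a component of `G`. -/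
lemma matching_or_linkedPacking (hm : m ≤ n) (hS : 4 * n + m ≤ #S + 1) :
    CliquePacking Gᶜ S m (fun _ => 2) ∨ LinkedPacking G n := by
  classical
  by_cases hM : CliquePacking Gᶜ S m fun _ => 2
  · exact .inl hM
  right
  -- A maximum matching of `Gᶜ` in `S`, with `k < m` edges; the set `I` of unmatched vertices is
  -- then a clique of `G`.
  obtain ⟨k, hkm, ⟨K, hK, hd⟩, hmax⟩ : ∃ k < m, CliquePacking Gᶜ S k (fun _ => 2) ∧
      ¬ CliquePacking Gᶜ S (k + 1) fun _ => 2 := by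
    by_contra! h
    have hall : ∀ k ≤ m, CliquePacking Gᶜ S k fun _ => 2 := by
      intro k
      induction k with
      | zero => exact fun _ => ⟨fun _ => ∅, by simp, by simp⟩
      | succ k ih => exact fun hk => h k (by omega) (ih (by omega))
    exact hM (hall m le_rfl)
  set I := S \ (range k).biUnion K with hI
  have hIS : I ⊆ S := sdiff_subset
  have hIK : ∀ i < k, ∀ x ∈ K i, x ∉ I := fun i hi x hx hxI =>
    (mem_sdiff.1 hxI).2 (mem_biUnion.2 ⟨i, mem_range.2 hi, hx⟩)
  have hIcard : #S ≤ #I + 2 * k := by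
    have h1 := le_card_sdiff ((range k).biUnion K) S
    have h2 : #((range k).biUnion K) ≤ 2 * k := by
      refine card_biUnion_le.trans ?_
      rw [sum_congr rfl fun i hi => (hK i (mem_range.1 hi)).2.2]
      simp
      omega
    rw [← hI] at h1
    omega
  have hpair : ∀ {x y : V}, Gᶜ.Adj x y → Gᶜ.IsNClique 2 {x, y} := fun h =>
    ⟨by rw [coe_pair]; exact SimpleGraph.isClique_pair.2 fun _ => h, card_pair h.ne⟩
  have hIclique : ∀ x ∈ I, ∀ y ∈ I, x ≠ y → G.Adj x y := by
    intro x hx y hy hxy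
    by_contra hadj
    have hxyI : ({x, y} : Finset V) ⊆ I := insert_subset hx (singleton_subset_iff.2 hy)
    have hdI : ∀ i < k, Disjoint (K i) {x, y} := fun i hi =>
      disjoint_left.2 fun v hv hv' => hIK i hi v hv (hxyI hv')
    refine hmax ⟨fun i => if i < k then K i else {x, y}, fun i hi => ?_, fun i hi j hj hij => ?_⟩
    · dsimp only
      split_ifs with h
      · exact hK i h
      · exact ⟨hxyI.trans hIS, hpair (by simp [hxy, hadj])⟩
    · dsimp only
      split_ifs with h h' h'
      · exact hd i h j h' hij
      · exact hdI i h
      · exact (hdI j h').symm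
      · omega
  -- If both ends of a matching edge had two `Gᶜ`-neighbours in `I`, distinct ones `u`, `v` could be
  -- chosen, and the augmenting path through them would enlarge the matching.
  have hend : ∀ i < k, ∃ x ∈ K i, #{v ∈ I | ¬ G.Adj x v} ≤ 1 := by
    intro i hi
    obtain ⟨x, y, hxy, hKxy⟩ := card_eq_two.1 (hK i hi).2.2
    by_contra! hcon
    have hxK : x ∈ K i := by simp [hKxy]
    have hyK : y ∈ K i := by simp [hKxy]
    obtain ⟨u, hu⟩ := card_pos.1 (zero_lt_one.trans (hcon x hxK))
    obtain ⟨v, hv, hvu⟩ := exists_mem_ne (hcon y hyK) u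
    rw [mem_filter] at hu hv
    have hne : ∀ {a b : V}, a ∈ K i → b ∈ I → a ≠ b := fun ha hb h => hIK i hi _ ha (h ▸ hb)
    have hxu : Gᶜ.Adj x u := by simp [hu.2, hne hxK hu.1]
    have hyv : Gᶜ.Adj y v := by simp [hv.2, hne hyK hv.1]
    have hsub : ∀ {a b : V}, a ∈ K i → b ∈ I → ({a, b} : Finset V) ⊆ K i ∪ I := fun ha hb =>
      insert_subset (mem_union_left _ ha) (singleton_subset_iff.2 (mem_union_right _ hb))
    have hdis : ∀ j < k, j ≠ i → Disjoint (K j) (K i ∪ I) := fun j hj hji =>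
      disjoint_union_right.2 ⟨hd j hj i hi hji, disjoint_left.2 fun a ha => hIK j hj a ha⟩
    have hdxy : Disjoint ({x, u} : Finset V) {y, v} := by
      have h1 := hne hxK hv.1
      have h2 := hne hyK hu.1
      simp [hxy.symm, h1.symm, h2, hvu]
    refine hmax ⟨fun j => if j = i then {x, u} else if j < k then K j else {y, v},
      fun j hj => ?_, fun j hj l hl hjl => ?_⟩
    · dsimp only
      split_ifs with h h'
      · exact ⟨(hsub hxK hu.1).trans (union_subset (hK i hi).1 hIS), hpair hxu⟩
      · exact hK j h'
      · exact ⟨(hsub hyK hv.1).trans (union_subset (hK i hi).1 hIS), hpair hyv⟩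
    · dsimp only
      split_ifs with h1 h2 h3 h4 h5 h6 h7 h8
      · omega
      · exact ((hdis l h3 h2).mono_right (hsub hxK hu.1)).symm
      · exact hdxy
      · exact (hdis j h4 h1).mono_right (hsub hxK hu.1)
      · exact hd j h4 l h6 hjl
      · exact (hdis j h4 h1).mono_right (hsub hyK hv.1)
      · exact hdxy.symm
      · exact ((hdis l h8 h7).mono_right (hsub hyK hv.1)).symm
      · omega
  obtain ⟨z, hz⟩ : I.Nonempty := card_pos.1 (by omega)
  have : Nonempty V := ⟨z⟩
  choose! x hxK hxI using hend
  -- The first `k` copies of `K₄` are an end `x i` with three of its neighbours in `I`; the others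
  -- lie inside `I`. They use `3k + 4(n-k) = 4n - k` vertices of `I`, and `#I ≥ 4n + m - 1 - 2k ≥ 4n
  -- - k`. Since `k < n`, the one possible non-neighbour of `x i` can always be avoided.
  obtain ⟨T, hT, hTd⟩ := exists_disjoint_family (S := I) (n := n)
    (P := fun i L => #L = (if i < k then 3 else 4) ∧ (i < k → ∀ v ∈ L, G.Adj (x i) v))
    (c := fun i => if i ≤ k then 3 * i else 4 * i - k) (by
      intro i hi U hU hcard
      by_cases hik : i < k
      · rw [if_pos hik.le] at hcard
        have hbad : #{v ∈ U | ¬ G.Adj (x i) v} ≤ 1 :=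
          (card_le_card (filter_subset_filter _ hU)).trans (hxI i hik)
        have hsplit := card_filter_add_card_filter_not (s := U) fun v => G.Adj (x i) v
        obtain ⟨L, hLU, hL⟩ := exists_subset_card_eq (s := {v ∈ U | G.Adj (x i) v}) (n := 3)
          (by omega)
        refine ⟨L, hLU.trans (filter_subset _ _), ⟨by rw [if_pos hik, hL],
          fun _ v hv => (mem_filter.1 (hLU hv)).2⟩, ?_⟩
        rw [if_pos hik.le, if_pos (by omega), hL]
        omega
      · obtain ⟨L, hLU, hL⟩ := exists_subset_card_eq (s := U) (n := 4)
          (by split_ifs at hcard <;> omega)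
        refine ⟨L, hLU, ⟨by rw [if_neg hik, hL], fun h => absurd h hik⟩, ?_⟩
        rw [if_neg (show ¬ i + 1 ≤ k by omega), hL]
        split_ifs <;> omega)
  have hTclique : ∀ i < n, G.IsClique (T i) := fun i hi a ha b hb hab =>
    hIclique a ((hT i hi).1 ha) b ((hT i hi).1 hb) hab
  have hreach : ∀ v ∈ I, G.Reachable z v := by
    intro v hv
    by_cases h : z = v
    · rw [h]
    · exact (hIclique z hz v hv h).reachable
  have hxT : ∀ i < k, ∀ j < n, x i ∉ T j := fun i hi j hj h =>
    hIK i hi _ (hxK i hi) ((hT j hj).1 h)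
  refine ⟨fun i => if i < k then insert (x i) (T i) else T i, fun i hi => ?_, ?_, z, ?_⟩
  · dsimp only
    split_ifs with h
    · have hcard := (hT i hi).2.1
      rw [if_pos h] at hcard
      exact SimpleGraph.IsNClique.insert ⟨hTclique i hi, hcard⟩ ((hT i hi).2.2 h)
    · have hcard := (hT i hi).2.1
      rw [if_neg h] at hcard
      exact ⟨hTclique i hi, hcard⟩
  · intro i hi j hj hij
    have hxx : i < k → j < k → x i ≠ x j := fun h h' he =>
      disjoint_left.1 (hd i h j h' hij) (hxK i h) (he ▸ hxK j h')
    dsimp only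
    split_ifs with h h' h'
    · rw [disjoint_insert_left, disjoint_insert_right, mem_insert]
      exact ⟨not_or.2 ⟨hxx h h', hxT i h j hj⟩, hxT j h' i hi, hTd i hi j hj hij⟩
    · rw [disjoint_insert_left]
      exact ⟨hxT i h j hj, hTd i hi j hj hij⟩
    · rw [disjoint_insert_right]
      exact ⟨hxT j h' i hi, hTd i hi j hj hij⟩
    · exact hTd i hi j hj hij
  · intro i hi v hv
    dsimp only at hv
    have hTI : ∀ v ∈ T i, G.Reachable z v := fun v hv => hreach v ((hT i hi).1 hv)
    split_ifs at hv with h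
    · rcases mem_insert.1 hv with rfl | hv
      · have hcard := (hT i hi).2.1
        rw [if_pos h] at hcard
        obtain ⟨u, hu⟩ : (T i).Nonempty := card_pos.1 (by omega)
        exact (hTI u hu).trans ((hT i hi).2.2 h u hu).symm.reachable
      · exact hTI v hv
    · exact hTI v hv

end Packing

/-! ### The upper bound, by analysis of the cuts of a disconnected colour. -/

section UpperBound

variable {V : Type*} {G : SimpleGraph V} {A B C S T U : Finset V} {n : ℕ}

lemma exists_compl_clique {t : ℕ} (hT : ∀ K ⊆ T, ¬ G.IsNClique 4 K) (hU : U ⊆ T)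
    (h : HasCliqueOrIndep G U 4 t) : ∃ K ⊆ U, Gᶜ.IsNClique t K := by
  obtain ⟨K, hK, h | h⟩ := h
  · exact absurd h (hT K (hK.trans hU))
  · exact ⟨K, hK, h⟩

/-- Removing at most `n - 1` copies of `K₄` leaves `4(n-1) + 18` vertices without one, enough to
pick `n` independent 4-sets greedily. The bound `8n + 10 ≤ 13n - 3` is what requires `n ≥ 3`. -/
lemma cliquePacking_or_compl (hn : 0 < n) (hS : 8 * n + 10 ≤ #S) :
    CliquePacking G S n (fun _ => 4) ∨ CliquePacking Gᶜ S n (fun _ => 4) := by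
  obtain ⟨n, rfl⟩ := Nat.exists_eq_add_of_lt hn
  rw [zero_add] at *
  obtain h | ⟨T, hTS, hcard, hT⟩ := cliquePacking_four_or_exists_residual (G := G) S n
  · exact .inl h
  · refine .inr (CliquePacking.mono (cliquePacking_of_step (c := fun i => 4 * i)
      (fun i _ => by omega) fun i hi U hU hUc => ?_) hTS)
    exact exists_compl_clique hT hU (hasCliqueOrIndep_four_four (by omega))

/-- Each side supplies `n` edges of `Gᶜ`, and an edge from each side together form a `K₄`. -/
lemma cliquePacking_of_two_parts [DecidableEq V] (hAB : ∀ x ∈ A, ∀ y ∈ B, Gᶜ.Adj x y)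
    (hA : 5 * n ≤ #A + 1) (hB : 5 * n ≤ #B + 1) :
    CliquePacking Gᶜ (A ∪ B) n (fun _ => 4) ∨ LinkedPacking G n := by
  obtain hA | h := matching_or_linkedPacking (G := G) (S := A) (m := n) (n := n) le_rfl (by omega)
  · obtain hB | h := matching_or_linkedPacking (G := G) (S := B) (m := n) (n := n) le_rfl (by omega)
    · exact .inl (hA.join hB hAB)
    · exact .inr h
  · exact .inr h

lemma edges_and_singletons_or_linkedPacking {a m : ℕ} (hm : m ≤ #S + 1 - 4 * n) (hS : n ≤ #S)
    (ham : a + m ≤ n) :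
    CliquePacking Gᶜ S n (fun i => if a ≤ i ∧ i < a + m then 2 else 1) ∨ LinkedPacking G n := by
  rcases Nat.eq_zero_or_pos m with rfl | hpos
  · refine .inl ((cliquePacking_singletons hS).congr fun i _ => ?_)
    rw [if_neg (by omega)]
  · obtain h | h := matching_or_linkedPacking (G := G) (S := S) (m := m) (n := n) (by omega)
      (by omega)
    · exact .inl (h.extend_singletons_shift ham (by omega))
    · exact .inr h

/-- A part `X` supplies `#X + 1 - 4n` edges of `Gᶜ`, and these numbers sum to at least `n`. Placing
the edges of the three parts in consecutive intervals of positions gives every position cliques of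
orders 2, 1, 1. -/
lemma cliquePacking_of_three_parts [DecidableEq V] (hAB : ∀ x ∈ A, ∀ y ∈ B, Gᶜ.Adj x y)
    (hC : ∀ x ∈ A ∪ B, ∀ y ∈ C, Gᶜ.Adj x y) (hA' : #A + 2 ≤ 5 * n) (hB' : #B + 2 ≤ 5 * n)
    (hC' : #C + 2 ≤ 5 * n) (hcard : 13 * n ≤ #A + #B + #C + 3) :
    CliquePacking Gᶜ (A ∪ B ∪ C) n (fun _ => 4) ∨ LinkedPacking G n := by
  obtain ⟨a, b, c, habc, ha, hb, hc⟩ : ∃ a b c, a + b + c = n ∧ a ≤ #A + 1 - 4 * n ∧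
      b ≤ #B + 1 - 4 * n ∧ c ≤ #C + 1 - 4 * n :=
    ⟨#A + 1 - 4 * n, min (#B + 1 - 4 * n) (n - (#A + 1 - 4 * n)),
      n - (#A + 1 - 4 * n) - min (#B + 1 - 4 * n) (n - (#A + 1 - 4 * n)), by omega, by omega,
      by omega, by omega⟩
  obtain hA | h := edges_and_singletons_or_linkedPacking (G := G) (S := A) (n := n) (a := 0) ha
    (by omega) (by omega)
  swap
  · exact .inr h
  obtain hB | h := edges_and_singletons_or_linkedPacking (G := G) (S := B) (n := n) (a := a) hb
    (by omega) (by omega)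
  swap
  · exact .inr h
  obtain hC₁ | h := edges_and_singletons_or_linkedPacking (G := G) (S := C) (n := n) (a := a + b) hc
    (by omega) (by omega)
  swap
  · exact .inr h
  refine .inl (((hA.join hB hAB).join hC₁ hC).congr fun i hi => ?_)
  split_ifs <;> omega

/-- Since `S` lies in one component, it may be assumed to have at most `n - 1` disjoint copies of
`K₄`; the residual `T` has no `K₄` and at least `9n + 1 - #A` vertices. -/
lemma cliquePacking_or_linkedPacking_of_reachable [DecidableEq V] {z : V} (hn : 2 ≤ n)
    (hz : ∀ x ∈ S, G.Reachable z x) (hSA : ∀ x ∈ S, ∀ y ∈ A, Gᶜ.Adj x y) (hA : 1 ≤ #A)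
    (hA' : #A + 2 ≤ 5 * n) (hcard : 13 * n ≤ #S + #A + 3) :
    CliquePacking Gᶜ (S ∪ A) n (fun _ => 4) ∨ LinkedPacking G n := by
  obtain h | ⟨T, hTS, hTcard, hT⟩ := cliquePacking_four_or_exists_residual (G := G) S (n - 1)
  · rw [Nat.sub_add_cancel (by omega)] at h
    exact .inr (h.linkedPacking hz)
  have hfour : ∀ U ⊆ T, 18 ≤ #U → ∃ K ⊆ U, Gᶜ.IsNClique 4 K := fun U hU h =>
    exists_compl_clique hT hU (hasCliqueOrIndep_four_four h)
  have hthree : ∀ U ⊆ T, 9 ≤ #U → ∃ K ⊆ U, Gᶜ.IsNClique 3 K := fun U hU h =>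
    exists_compl_clique hT hU (hasCliqueOrIndep_four_three h)
  have htwo : ∀ U ⊆ T, 4 ≤ #U → ∃ K ⊆ U, Gᶜ.IsNClique 2 K := fun U hU h =>
    exists_compl_clique hT hU (hasCliqueOrIndep_two h)
  -- Here `T` is only known to have 11 vertices, one short of the `3 + 9` needed for two greedy
  -- triples. Instead a triple is joined to a vertex of `A`, and a pair to an edge of `Gᶜ` in `A`.
  by_cases hex : n = 2 ∧ #A = 8
  · obtain ⟨rfl, hA8⟩ := hex
    obtain hAp | h := edges_and_singletons_or_linkedPacking (G := G) (S := A) (n := 2) (a := 1)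
      (m := 1) (by omega) (by omega) (by omega)
    swap
    · exact .inr h
    have hTp : CliquePacking Gᶜ T 2 fun i => if 1 ≤ i ∧ i < 1 + 1 then 2 else 3 := by
      refine cliquePacking_of_step (c := fun i => 3 * i) (fun i _ => by split_ifs <;> omega) ?_
      intro i hi U hU hUc
      split_ifs
      · exact htwo U hU (by omega)
      · exact hthree U hU (by omega)
    refine .inl (((hTp.mono hTS).join hAp hSA).congr fun i hi => ?_)
    split_ifs <;> omega
  -- The set `A` completes `r` independent triples of `T`; the other `n - r` copies are independent
  -- 4-sets, chosen first because they need 18 remaining vertices rather than 9.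
  · obtain ⟨r, hr⟩ : ∃ r, r = min #A n := ⟨_, rfl⟩
    have hTp : CliquePacking Gᶜ T n fun i => if i < n - r then 4 else 3 := by
      refine cliquePacking_of_step (c := fun i => if i ≤ n - r then 4 * i else 3 * i + (n - r))
        (fun i _ => by split_ifs <;> omega) ?_
      intro i hi U hU hUc
      split_ifs with h
      · rw [if_pos h.le] at hUc
        exact hfour U hU (by omega)
      · refine hthree U hU ?_
        split_ifs at hUc <;> omega
    have hAp : CliquePacking Gᶜ A n fun i => if i < n - r then 0 else 1 := by
      refine cliquePacking_of_step (c := fun i => i - (n - r))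
        (fun i _ => by split_ifs <;> omega) ?_
      intro i hi U hU hUc
      split_ifs with h
      · exact ⟨∅, empty_subset U, by simp⟩
      · obtain ⟨x, hx⟩ : U.Nonempty := card_pos.1 (by omega)
        exact ⟨{x}, singleton_subset_iff.2 hx, by simp⟩
    refine .inl (((hTp.mono hTS).join hAp hSA).congr fun i hi => ?_)
    split_ifs <;> omega

lemma cliquePacking_or_linkedPacking_of_not_preconnected [Fintype V] (hn : 2 ≤ n)
    (hV : Fintype.card V = 13 * n - 3) (hG : ¬ G.Preconnected) :
    CliquePacking Gᶜ univ n (fun _ => 4) ∨ LinkedPacking G n := by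
  classical
  let IsCut : Finset V → Prop := fun A => ∀ x ∈ A, ∀ y ∉ A, ¬ G.Adj x y
  have hcompl : ∀ {A}, IsCut A → IsCut Aᶜ := fun hA x hx y hy h =>
    hA y (by simpa using hy) x (by simpa using hx) h.symm
  have hreach : ∀ x, IsCut {v | G.Reachable x v} := fun x u hu v hv h => by
    simp only [mem_filter, mem_univ, true_and] at hu hv
    exact hv (hu.trans h.reachable)
  have hjoin : ∀ {A}, IsCut A → ∀ x ∈ Aᶜ, ∀ y ∈ A, Gᶜ.Adj x y := fun {A} hA x hx y hy => by
    rw [mem_compl] at hx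
    have hne : x ≠ y := fun h => hx (h ▸ hy)
    have := hA y hy x hx
    rw [G.adj_comm] at this
    simp [hne, this]
  by_contra! hcon
  -- Otherwise both sides of the cut have at least `5n - 1` vertices, and the two-part construction
  -- applies.
  have hsize : ∀ {A}, IsCut A → #A + 2 ≤ 5 * n ∨ 8 * n ≤ #A + 1 := fun {A} hA => by
    by_contra! h
    have hc := card_add_card_compl A
    obtain h | h := cliquePacking_of_two_parts (n := n) (hjoin hA) (by omega) (by omega)
    · exact hcon.1 (h.mono (subset_univ _))
    · exact hcon.2 h
  obtain ⟨x₀, y₀, hxy₀⟩ : ∃ x y, ¬ G.Reachable x y := by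
    simpa [SimpleGraph.Preconnected] using hG
  obtain ⟨A₀, hA₀, hA₀pos, hA₀le⟩ : ∃ A, IsCut A ∧ 1 ≤ #A ∧ #A + 2 ≤ 5 * n := by
    have hX := hreach x₀
    have hc := card_add_card_compl ({v | G.Reachable x₀ v} : Finset V)
    have h1 : 0 < #({v | G.Reachable x₀ v} : Finset V) := card_pos.2 ⟨x₀, by simp⟩
    have h2 : 0 < #({v | G.Reachable x₀ v} : Finset V)ᶜ := card_pos.2 ⟨y₀, by simpa using hxy₀⟩
    rcases hsize hX with h | h
    · exact ⟨_, hX, h1, h⟩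
    · exact ⟨_, hcompl hX, h2, by omega⟩
  obtain ⟨A, hAmem, hAmax⟩ := exists_max_image
    ({A | IsCut A ∧ #A + 2 ≤ 5 * n} : Finset (Finset V)) card ⟨A₀, by simp [hA₀, hA₀le]⟩
  simp only [mem_filter, mem_univ, true_and, and_imp] at hAmem hAmax
  obtain ⟨hA, hAle⟩ := hAmem
  have hApos := hA₀pos.trans (hAmax A₀ hA₀ hA₀le)
  have hAc := card_add_card_compl A
  by_cases hS : ∀ x ∈ Aᶜ, ∀ y ∈ Aᶜ, G.Reachable x y
  · obtain ⟨z, hz⟩ : Aᶜ.Nonempty := card_pos.1 (by omega)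
    obtain h | h := cliquePacking_or_linkedPacking_of_reachable hn (hS z hz) (hjoin hA) hApos hAle
      (by omega)
    · exact hcon.1 (h.mono (subset_univ _))
    · exact hcon.2 h
  · push Not at hS
    obtain ⟨x, hx, y, hy, hxy⟩ := hS
    obtain ⟨B, hB⟩ : ∃ B : Finset V, B = ({v | G.Reachable x v} : Finset V) := ⟨_, rfl⟩
    have hBcut : IsCut B := hB ▸ hreach x
    have hxB : x ∈ B := by simp [hB]
    have hyB : y ∉ B := by simp [hB, hxy]
    have hBA : B ⊆ Aᶜ := by
      intro v hv
      rw [mem_compl]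
      intro hvA
      rw [hB, mem_filter] at hv
      have hvx := hv.2.symm
      have key : ∀ {u w : V}, G.Walk u w → u ∈ A → w ∈ A := by
        intro u w p
        induction p with
        | nil => exact id
        | @cons a b c hab p ih =>
          intro ha
          exact ih (by_contra fun hb => hA a ha b hb hab)
      obtain ⟨p⟩ := hvx
      exact (mem_compl.1 hx) (key p hvA)
    have hdAB : Disjoint A B := disjoint_left.2 fun v hv hvB => mem_compl.1 (hBA hvB) hv
    have hABcut : IsCut (A ∪ B) := by
      intro u hu v hv h
      rw [mem_union, not_or] at hv
      rcases mem_union.1 hu with hu | hu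
      · exact hA u hu v hv.1 h
      · exact hBcut u hu v hv.2 h
    have hCcut : IsCut (A ∪ (A ∪ B)ᶜ) := by
      intro u hu v hv h
      rw [mem_union, not_or] at hv
      rcases mem_union.1 hu with hu | hu
      · exact hA u hu v hv.1 h
      · exact hcompl hABcut u hu v hv.2 h
    have hABcard : #(A ∪ B) = #A + #B := card_union_of_disjoint hdAB
    have hABc := card_add_card_compl (A ∪ B)
    have hCcard : #(A ∪ (A ∪ B)ᶜ) = #A + #(A ∪ B)ᶜ := card_union_of_disjoint
      (disjoint_left.2 fun v hv hv' => mem_compl.1 hv' (mem_union_left _ hv))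
    have hBpos : 0 < #B := card_pos.2 ⟨x, hxB⟩
    have hCpos : 0 < #(A ∪ B)ᶜ := card_pos.2 ⟨y, by
      rw [mem_compl, mem_union, not_or]
      exact ⟨mem_compl.1 hy, hyB⟩⟩
    -- By maximality of `A` a strictly larger cut must fall in the upper range, so the third part
    -- has at most `5n - 2` vertices; exchanging the roles of `B` and the third part bounds `B`.
    have h1 : 8 * n ≤ #(A ∪ B) + 1 := (hsize hABcut).resolve_left fun h => by
      have := hAmax _ hABcut h
      omega
    have h2 : 8 * n ≤ #(A ∪ (A ∪ B)ᶜ) + 1 := (hsize hCcut).resolve_left fun h => by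
      have := hAmax _ hCcut h
      omega
    obtain h | h := cliquePacking_of_three_parts (n := n) (A := A) (B := B) (C := (A ∪ B)ᶜ)
      (fun u hu v hv => (hjoin hA v (hBA hv) u hu).symm)
      (fun u hu v hv => (hjoin hABcut v hv u hu).symm) hAle (by omega) (by omega) (by omega)
    · exact hcon.1 (h.mono (subset_univ _))
    · exact hcon.2 h

lemma linkedPacking_or_compl [Fintype V] (hn : 2 ≤ n) (hV : Fintype.card V = 13 * n - 3)
    (hpack : CliquePacking G univ n (fun _ => 4) ∨ CliquePacking Gᶜ univ n (fun _ => 4)) :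
    LinkedPacking G n ∨ LinkedPacking Gᶜ n := by
  have : Nonempty V := Fintype.card_pos_iff.1 (by omega)
  obtain ⟨z⟩ := this
  by_cases hG : G.Preconnected
  · by_cases hG' : Gᶜ.Preconnected
    · exact hpack.imp (·.linkedPacking fun x _ => hG z x) (·.linkedPacking fun x _ => hG' z x)
    · obtain h | h := cliquePacking_or_linkedPacking_of_not_preconnected hn hV hG'
      · rw [compl_compl] at h
        exact .inl (h.linkedPacking fun x _ => hG z x)
      · exact .inr h
  · obtain h | h := cliquePacking_or_linkedPacking_of_not_preconnected hn hV hG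
    · have hG' : Gᶜ.Preconnected := G.connected_or_preconnected_compl.resolve_left
        fun h => hG h.preconnected
      exact .inr (h.linkedPacking fun x _ => hG' z x)
    · exact .inl h

end UpperBound

/-! ### Passage between edge colourings and packings. -/

section Transfer

variable {V : Type*} {G : SimpleGraph V} {n : ℕ}

/-- The connected graph is the whole component holding the copies, relabelled by `Fin`. -/
lemma exists_connectedContaining_of_linkedPacking [Finite V] (h : LinkedPacking G n) :
    ∃ H ∈ connectedContaining (copiesOfComplete n 4), H.2 ⊑ G := by
  obtain ⟨K, hK, hd, z, hz⟩ := h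
  let Z := G.connectedComponentMk z
  let e : Z.supp ≃ Fin (Nat.card Z.supp) := Finite.equivFin _
  let φ : Z.toSimpleGraph ≃g Z.toSimpleGraph.map e.toEmbedding := SimpleGraph.Iso.map e _
  refine ⟨⟨_, Z.toSimpleGraph.map e.toEmbedding⟩,
    ⟨φ.connected_iff.1 Z.connected_toSimpleGraph, ?_⟩, ?_⟩
  · refine SimpleGraph.IsContained.trans ?_ φ.isContained
    have hmem : ∀ i : Fin n, ∀ x ∈ K i, x ∈ Z.supp := fun i x hx => by
      rw [SimpleGraph.ConnectedComponent.mem_supp_iff]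
      exact SimpleGraph.ConnectedComponent.sound (hz i i.2 x hx).symm
    let f : ∀ i : Fin n, Fin 4 ≃ K i := fun i => ((K i).equivFinOfCardEq (hK i i.2).2).symm
    refine ⟨⟨⟨fun p => ⟨f p.1 p.2, hmem _ _ (f p.1 p.2).2⟩, ?_⟩, ?_⟩⟩
    · rintro ⟨i, a⟩ ⟨j, b⟩ ⟨hij, hab⟩
      obtain rfl : i = j := hij
      exact (hK i i.2).1 (f i a).2 (f i b).2 fun h => hab ((f i).injective (Subtype.ext h))
    · rintro ⟨i, a⟩ ⟨j, b⟩ hab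
      have hab' : (f i a : V) = f j b := congrArg Subtype.val hab
      by_cases hij : i = j
      · subst hij
        rw [(f i).injective (Subtype.ext hab')]
      · exact absurd (hab' ▸ (f j b).2)
          (disjoint_left.1 (hd i i.2 j j.2 fun h => hij (Fin.ext h)) (f i a).2)
  · exact φ.isContained'.trans ⟨⟨Z.toSimpleGraph_hom, Subtype.val_injective⟩⟩

lemma cliquePacking_of_isContained [Fintype V] (h : copiesOfComplete n 4 ⊑ G) :
    CliquePacking G univ n fun _ => 4 := by
  classical
  obtain ⟨f⟩ := h
  refine ⟨fun i => if hi : i < n then univ.image fun a => f (⟨i, hi⟩, a) else ∅, ?_, ?_⟩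
  · intro i hi
    refine ⟨subset_univ _, ?_⟩
    simp only [dif_pos hi]
    constructor
    · intro x hx y hy hxy
      simp only [coe_image, coe_univ, Set.image_univ, Set.mem_range] at hx hy
      obtain ⟨a, rfl⟩ := hx
      obtain ⟨b, rfl⟩ := hy
      exact f.toHom.map_adj ⟨rfl, fun hab => hxy (congrArg (fun c => f (⟨i, hi⟩, c)) hab)⟩
    · rw [card_image_of_injective, card_univ, Fintype.card_fin]
      exact fun a b hab => (Prod.ext_iff.1 (f.injective hab)).2
  · intro i hi j hj hij
    simp only [dif_pos hi, dif_pos hj]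
    refine disjoint_left.2 fun x hx hx' => ?_
    simp only [mem_image, mem_univ, true_and] at hx hx'
    obtain ⟨a, rfl⟩ := hx
    obtain ⟨b, hb⟩ := hx'
    exact hij (Fin.mk.inj (Prod.ext_iff.1 (f.injective hb)).1).symm

lemma labelGraph_zero_eq_compl (C : SimpleGraph.TopEdgeLabeling V (Fin 2)) :
    C.labelGraph 0 = (C.labelGraph 1)ᶜ := by
  classical
  conv_lhs => rw [← C.labelGraph_toTopEdgeLabeling]
  exact SimpleGraph.toTopEdgeLabeling_labelGraph_compl _

lemma Arrows.mono {k N M : ℕ} {F : GraphFamily} (h : Arrows k N F) (hNM : N ≤ M) :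
    Arrows k M F := by
  intro C
  obtain ⟨c, H, hH, hc⟩ := h (C.pullback (Fin.castLEEmb hNM))
  refine ⟨c, H, hH, hc.trans ⟨⟨⟨Fin.castLEEmb hNM, ?_⟩, (Fin.castLEEmb hNM).injective⟩⟩⟩
  intro x y hxy
  rw [SimpleGraph.TopEdgeLabeling.labelGraph_adj] at hxy ⊢
  obtain ⟨hne, hget⟩ := hxy
  exact ⟨fun h => hne ((Fin.castLEEmb hNM).injective h), hget⟩

lemma arrows_connectedContaining (hn : 2 ≤ n)
    (hpack : ∀ G : SimpleGraph (Fin (13 * n - 3)),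
      CliquePacking G univ n (fun _ => 4) ∨ CliquePacking Gᶜ univ n (fun _ => 4)) :
    Arrows 2 (13 * n - 3) (connectedContaining (copiesOfComplete n 4)) := by
  intro C
  obtain h | h := linkedPacking_or_compl hn (Fintype.card_fin _) (hpack (C.labelGraph 1))
  · exact ⟨1, exists_connectedContaining_of_linkedPacking h⟩
  · rw [← labelGraph_zero_eq_compl] at h
    exact ⟨0, exists_connectedContaining_of_linkedPacking h⟩

lemma cliquePacking_or_compl_of_arrows {N : ℕ}
    (h : Arrows 2 N (singleGraph (copiesOfComplete n 4))) (G : SimpleGraph (Fin N)) :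
    CliquePacking G univ n (fun _ => 4) ∨ CliquePacking Gᶜ univ n (fun _ => 4) := by
  classical
  obtain ⟨c, H, ⟨e⟩, hc⟩ := h G.toTopEdgeLabeling
  have hcont := e.isContained'.trans hc
  fin_cases c
  · rw [← SimpleGraph.toTopEdgeLabeling_labelGraph_compl]
    exact .inr (cliquePacking_of_isContained hcont)
  · refine .inl (cliquePacking_of_isContained ?_)
    rw [← SimpleGraph.toTopEdgeLabeling_labelGraph G]
    exact hcont

end Transfer

/-! ### The extremal colouring on `13 * n - 4` vertices. -/

section LowerBound

variable {n N : ℕ}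

/-- The block of a vertex: three blocks of `4 * n - 1` vertices, and a last one. -/
def block (n x : ℕ) : ℕ := min (x / (4 * n - 1)) 3

/-- The disjoint union of the complete graphs on the blocks. -/
def blockGraph (n N : ℕ) : SimpleGraph (Fin N) where
  Adj x y := x ≠ y ∧ block n x = block n y
  symm := ⟨fun _ _ h => ⟨h.1.symm, h.2.symm⟩⟩
  loopless := ⟨fun _ h => h.1 rfl⟩

lemma card_block_lt (hn : 1 ≤ n) (hN : N + 4 ≤ 13 * n) (c : ℕ) :
    #{x : Fin N | block n x = c} < 4 * n := by
  have h : #{x : Fin N | block n x = c} ≤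
      #(Ico (c * (4 * n - 1)) (c * (4 * n - 1) + (4 * n - 1))) := by
    refine card_le_card_of_injOn Fin.val ?_ Fin.val_injective.injOn
    intro x hx
    have hx' : block n x = c := by simpa using hx
    have hxN := x.2
    have hpos : 0 < 4 * n - 1 := by omega
    have h1 := Nat.div_mul_le_self x (4 * n - 1)
    have h2 := Nat.lt_div_mul_add (a := x) hpos
    rw [coe_Ico, Set.mem_Ico]
    unfold block at hx'
    -- As `13n - 4 ≤ 4(4n - 1)`, the cap at 3 in `block` never takes effect.
    have h3 : (x : ℕ) / (4 * n - 1) < 4 := by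
      rw [Nat.div_lt_iff_lt_mul hpos]
      omega
    have h4 : (x : ℕ) / (4 * n - 1) = c := by omega
    rw [h4] at h1 h2
    exact ⟨h1, h2⟩
  rw [Nat.card_Ico] at h
  omega

lemma card_last_block_lt (hn : 1 ≤ n) (hN : N + 4 ≤ 13 * n) :
    #{x : Fin N | block n x = 3} < n := by
  have h : #{x : Fin N | block n x = 3} ≤ #(Ico (3 * (4 * n - 1)) N) := by
    refine card_le_card_of_injOn Fin.val ?_ Fin.val_injective.injOn
    intro x hx
    have hx' : block n x = 3 := by simpa using hx
    have hpos : 0 < 4 * n - 1 := by omega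
    rw [coe_Ico, Set.mem_Ico, ← Nat.le_div_iff_mul_le hpos]
    unfold block at hx'
    exact ⟨by omega, x.2⟩
  rw [Nat.card_Ico] at h
  omega

lemma not_isContained_blockGraph (hn : 1 ≤ n) (hN : N + 4 ≤ 13 * n) {V : Type*}
    {H : SimpleGraph V} (hH : H.Connected) (hc : copiesOfComplete n 4 ⊑ H) :
    ¬ H ⊑ blockGraph n N := by
  rintro ⟨f⟩
  obtain ⟨g⟩ := hc
  obtain ⟨z⟩ := hH.nonempty
  have hconst : ∀ x, block n (f x) = block n (f z) := by
    intro x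
    obtain ⟨p⟩ := hH.preconnected x z
    induction p with
    | nil => rfl
    | cons h p ih => exact (f.toHom.map_adj h).2.trans ih
  refine (card_block_lt hn hN (block n (f z))).not_ge ?_
  have hcard : Fintype.card (Fin n × Fin 4) ≤ #{x : Fin N | block n x = block n (f z)} :=
    card_le_card_of_injOn (s := univ) (fun p => f (g p)) (fun p _ => by simp [hconst])
      (f.injective.comp g.injective).injOn
  simp at hcard
  omega

lemma not_copies_isContained_blockGraph_compl (hn : 1 ≤ n) (hN : N + 4 ≤ 13 * n) :
    ¬ copiesOfComplete n 4 ⊑ (blockGraph n N)ᶜ := by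
  rintro ⟨f⟩
  have hlast : ∀ i : Fin n, ∃ a : Fin 4, block n (f (i, a)) = 3 := by
    intro i
    have hmaps : ∀ a : Fin 4, block n (f (i, a)) < 4 := fun a => by
      unfold block
      omega
    -- The vertices of a `K₄` in the complement lie in distinct blocks; there are only four blocks,
    -- so the last one is hit.
    have hinj : Function.Injective fun a : Fin 4 => (⟨block n (f (i, a)), hmaps a⟩ : Fin 4) := by
      intro a b hab
      by_contra hne
      have hadj := f.toHom.map_adj (show (copiesOfComplete n 4).Adj (i, a) (i, b) from ⟨rfl, hne⟩)
      rw [SimpleGraph.compl_adj] at hadj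
      exact hadj.2 ⟨hadj.1, Fin.mk.inj hab⟩
    obtain ⟨a, ha⟩ := (Finite.injective_iff_surjective.1 hinj) 3
    exact ⟨a, congrArg Fin.val ha⟩
  choose a ha using hlast
  refine (card_last_block_lt hn hN).not_ge ?_
  have hcard : Fintype.card (Fin n) ≤ #{x : Fin N | block n x = 3} :=
    card_le_card_of_injOn (s := univ) (fun i => f (i, a i)) (fun i _ => by simp [ha])
      (fun i _ j _ hij => (Prod.ext_iff.1 (f.injective hij)).1)
  simpa using hcard

lemma le_of_arrows_connectedContaining (hn : 1 ≤ n)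
    (h : Arrows 2 N (connectedContaining (copiesOfComplete n 4))) : 13 * n - 3 ≤ N := by
  classical
  by_contra! hN
  obtain ⟨c, H, ⟨hH, hcH⟩, hc⟩ := h (blockGraph n N).toTopEdgeLabeling
  fin_cases c
  · refine not_copies_isContained_blockGraph_compl (n := n) (N := N) hn (by omega) ?_
    rw [← SimpleGraph.toTopEdgeLabeling_labelGraph_compl]
    exact hcH.trans hc
  · refine not_isContained_blockGraph (n := n) (N := N) hn (by omega) hH hcH ?_
    rw [← SimpleGraph.toTopEdgeLabeling_labelGraph (blockGraph n N)]
    exact hc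

end LowerBound

end RamseyClique

theorem theorem3 :
    (∀ n : ℕ, 3 ≤ n →
      RamseyClique.IsRamseyNumber 2
        (RamseyClique.connectedContaining (RamseyClique.copiesOfComplete n 4)) (13 * n - 3)) ∧
    ((∃ R : ℕ, RamseyClique.IsRamseyNumber 2
        (RamseyClique.singleGraph (RamseyClique.copiesOfComplete 2 4)) R ∧ R ≤ 23) →
      RamseyClique.IsRamseyNumber 2
        (RamseyClique.connectedContaining (RamseyClique.copiesOfComplete 2 4)) 23) := by
  refine ⟨fun n hn => ⟨?_, fun N hN => ?_⟩, fun ⟨R, hR, hR23⟩ => ⟨?_, fun N hN => ?_⟩⟩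
  · refine RamseyClique.arrows_connectedContaining (by omega) fun G =>
      RamseyClique.cliquePacking_or_compl (by omega) ?_
    rw [Finset.card_univ, Fintype.card_fin]
    omega
  · exact RamseyClique.le_of_arrows_connectedContaining (by omega) hN
  · exact RamseyClique.arrows_connectedContaining (n := 2) le_rfl
      (RamseyClique.cliquePacking_or_compl_of_arrows (hR.1.mono hR23))
  · exact RamseyClique.le_of_arrows_connectedContaining (n := 2) (by omega) hN
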